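/- Let $0\le N\le n$ be integers, let $\beta\in\{1,2,4\}$ and let $\mathbb F_\beta$ be respectively $\mathbb R$, $\mathbb C$, or the real quaternions. Let $\mathrm d\mathbf v$ denote Lebesgue measure in the real components of a vector $\mathbf v$ with entries in $\mathbb F_\beta$, put $\sigma_l=2\pi^{l/2}/\Gamma(l/2)$, and let $\mathcal P_{+,N}^{\beta}$ be the set of $N\times N$ Hermitian matrices over $\mathbb F_\beta$ with all eigenvalues non-negative. For a square matrix $V$ over the quaternions, $|\det V|$ denotes the product of its singular values, i.e. the square root of the modulus of the determinant of the complex matrix of twice the size that represents $V$. For vectors $\mathbf v_k^n\in(\mathbb F_\beta)^n$ and $\mathbf v_k^N\in(\mathbb F_\beta)^N$ $(k=0,\dots,N)$ put $$V_n=[\mathbf v_k^n-\mathbf v_0^n]_{k=1}^N,\qquad V_N=[\mathbf v_k^N-\mathbf v_0^N]_{k=1}^N,\qquad C=\prod_{i=1}^N\frac{\sigma_{\beta(n-i+1)}}{\sigma_{\beta(N-i+1)}} .$$ Below, unless it is held fixed separately, $\mathbf v_0^N$ is any given measurable function of $\mathbf v_0^n$, for example $\mathbf v_0^N=B^\dagger\mathbf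 v_0^n$ with $B$ a fixed $n\times N$ matrix such that $B^\dagger B=I_N$. All functions $f$ on $\mathcal P_{+,N}^{\beta}$ are assumed measurable. (a) For every $f:\mathcal P_{+,N}^{\beta}\to[0,\infty]$, $$\int_{\mathbf v_k^n\in(\mathbb F_\beta)^n} f(V_n^\dagger V_n)\prod_{k=0}^N\mathrm d\mathbf v_k^n = C\int_{\mathbf v_0^n\in(\mathbb F_\beta)^n,\ \mathbf v_k^N\in(\mathbb F_\beta)^N} f(V_N^\dagger V_N)\,|\det V_N|^{\beta(n-N)}\,\mathrm d\mathbf v_0^n\prod_{k=1}^N\mathrm d\mathbf v_k^N$$ as an identity in $[0,\infty]$. (b) For every $f:\mathcal P_{+,N}^{\beta}\to\mathbb R$ and every measurable $\varphi:(\mathbb F_\beta)^n\to\mathbb R$, the two integrals in $$\int_{\mathbf v_k^n\in(\mathbb F_\beta)^n} \varphi(\mathbf v_0^n)f(V_n^\dagger V_n)\prod_{k=0}^N\mathrm d\mathbf v_k^n = C\int_{\mathbf v_0^n\in(\mathbb F_\beta)^n,\ \mathbf v_k^N\in(\mathbb F_\beta)^N} \varphi(\mathbf v_0^n)f(V_N^\dagger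 V_N)\,|\det V_N|^{\beta(n-N)}\,\mathrm d\mathbf v_0^n\prod_{k=1}^N\mathrm d\mathbf v_k^N$$ are either both absolutely convergent or both not, and in the former case the equality holds. (c) For every $f:\mathcal P_{+,N}^{\beta}\to\mathbb R$ and all fixed $\mathbf v_0^n\in(\mathbb F_\beta)^n$ and $\mathbf v_0^N\in(\mathbb F_\beta)^N$, the two integrals in $$\int_{\mathbf v_k^n\in(\mathbb F_\beta)^n} f(V_n^\dagger V_n)\prod_{k=1}^N\mathrm d\mathbf v_k^n = C\int_{\mathbf v_k^N\in(\mathbb F_\beta)^N} f(V_N^\dagger V_N)\,|\det V_N|^{\beta(n-N)}\prod_{k=1}^N\mathrm d\mathbf v_k^N$$ are either both absolutely convergent or both not, and in the former case the equality holds. -/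

import Mathlib

open MeasureTheory
open scoped Quaternion ENNReal Matrix

noncomputable section

namespace AffineGram

/-- The Borel structure on the real quaternions. The resulting volume (for the norm
`a² + b² + c² + d²`) is Lebesgue measure in the four real components. -/
instance : MeasurableSpace ℍ[ℝ] := borel ℍ[ℝ]

instance : BorelSpace ℍ[ℝ] := ⟨rfl⟩

/-- The identity `z̄ z = |z|²`, which holds in `ℝ`, `ℂ` and the real quaternions. -/
class StarNorm (F : Type) [NormedDivisionRing F] [NormedAlgebra ℝ F] [StarRing F] : Prop where
  star_mul_self' : ∀ a : F, star a * a = algebraMap ℝ F (‖a‖ ^ 2)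

instance : StarNorm ℝ where
  star_mul_self' a := by simp [sq]

instance : StarNorm ℂ where
  star_mul_self' a := by
    have h := Complex.conj_mul' a
    simpa using h

instance : StarNorm ℍ[ℝ] where
  star_mul_self' a := by
    rw [Quaternion.star_mul_self, Quaternion.normSq_eq_norm_mul_self, ← sq]
    rfl

section General

variable (F : Type) [NormedDivisionRing F] [NormedAlgebra ℝ F] [StarRing F] [StarNorm F]

/-- The set of `N × N` Hermitian matrices over `F` all of whose eigenvalues are non-negative
(the eigenvalues of a Hermitian matrix are real). -/
def PSD (N : ℕ) : Type :=
  {W : Matrix (Fin N) (Fin N) F //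
    W.IsHermitian ∧ ∀ (l : ℝ) (x : Fin N → F), x ≠ 0 → W *ᵥ x = l • x → 0 ≤ l}

/-- The Borel structure on `PSD F N`, as a subset of the space of all matrices. -/
instance (N : ℕ) [MeasurableSpace F] : MeasurableSpace (PSD F N) :=
  MeasurableSpace.comap (fun W (i j : Fin N) => W.1 i j) inferInstance

variable {F}

/-- The `m × N` matrix whose columns are `z 0, …, z (N - 1)`. -/
def columns {m N : ℕ} (z : Fin N → Fin m → F) : Matrix (Fin m) (Fin N) F :=
  Matrix.of fun i k => z k i

theorem dot_star_self {m : ℕ} (x : Fin m → F) :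
    star x ⬝ᵥ x = algebraMap ℝ F (∑ i, ‖x i‖ ^ 2) := by
  simp only [dotProduct, Pi.star_apply, StarNorm.star_mul_self', map_sum]

theorem gram_mem {m N : ℕ} (V : Matrix (Fin m) (Fin N) F) :
    (Vᴴ * V).IsHermitian ∧
      ∀ (l : ℝ) (x : Fin N → F), x ≠ 0 → (Vᴴ * V) *ᵥ x = l • x → 0 ≤ l := by
  refine ⟨Matrix.isHermitian_conjTranspose_mul_self V, fun l x hx h => ?_⟩
  have h1 : star x ⬝ᵥ ((Vᴴ * V) *ᵥ x) = star (V *ᵥ x) ⬝ᵥ (V *ᵥ x) := by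
    rw [← Matrix.mulVec_mulVec, Matrix.dotProduct_mulVec, Matrix.star_mulVec]
  rw [h, dotProduct_smul, dot_star_self, dot_star_self, Algebra.smul_def, ← map_mul] at h1
  have h2 := (algebraMap ℝ F).injective h1
  have h3 : 0 < ∑ i, ‖x i‖ ^ 2 := by
    obtain ⟨i, hi⟩ := Function.ne_iff.mp hx
    exact Finset.sum_pos' (fun j _ => by positivity)
      ⟨i, Finset.mem_univ i, pow_pos (norm_pos_iff.mpr hi) 2⟩
  refine nonneg_of_mul_nonneg_left ?_ h3
  rw [h2]
  positivity

/-- The matrix `V† V` as an element of the cone of non-negative Hermitian matrices. -/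
def gram {m N : ℕ} (V : Matrix (Fin m) (Fin N) F) : PSD F N :=
  ⟨Vᴴ * V, gram_mem V⟩

end General

/-- The `2 × 2` complex matrix `[[z, w], [-w̄, z̄]]`, `z = a + b i`, `w = c + d i`, representing the
quaternion `a + b i + c j + d k`. -/
def block (q : ℍ[ℝ]) : Matrix (Fin 2) (Fin 2) ℂ :=
  !![⟨q.re, q.imI⟩, ⟨q.imJ, q.imK⟩; -star (⟨q.imJ, q.imK⟩ : ℂ), star (⟨q.re, q.imI⟩ : ℂ)]

/-- The `2N × 2N` complex matrix representing an `N × N` quaternion matrix. -/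
def complexForm {N : ℕ} (M : Matrix (Fin N) (Fin N) ℍ[ℝ]) :
    Matrix (Fin N × Fin 2) (Fin N × Fin 2) ℂ :=
  Matrix.of fun p q => block (M p.1 q.1) p.2 q.2

/-- `|det M|` for a quaternion matrix, the product of the singular values of `M`. In `complexForm M`
each singular value occurs twice, so this is the square root of the modulus of its determinant. -/
def quatAbsDet {N : ℕ} (M : Matrix (Fin N) (Fin N) ℍ[ℝ]) : ℝ :=
  √‖(complexForm M).det‖

/-- The surface area `2 π^(l/2) / Γ(l/2)` of the unit sphere in `ℝ^l`. -/
def sphereArea (l : ℕ) : ℝ :=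
  2 * Real.pi ^ ((l : ℝ) / 2) / Real.Gamma ((l : ℝ) / 2)

/-- The volume of the Grassmannian of `N`-dimensional subspaces of `F^n`, where `dim_ℝ F = β`. -/
def grassmannVolume (β n N : ℕ) : ℝ :=
  ∏ i ∈ Finset.Icc 1 N, sphereArea (β * (n - i + 1)) / sphereArea (β * (N - i + 1))

section Formula

variable (F : Type) [NormedDivisionRing F] [NormedAlgebra ℝ F] [StarRing F] [StarNorm F]
  [MeasureSpace F]

/-- The image on the cone of Lebesgue measure on `N × N` matrices under `V ↦ V† V`. It has the same
null sets as Lebesgue measure on Hermitian matrices restricted to the cone. -/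
def coneMeasure (N : ℕ) : Measure (PSD F N) :=
  Measure.map (fun z : Fin N → Fin N → F => gram (columns z)) volume

/-- The affine integration formula over `F`, where `dim_ℝ F = β` and `absDet` is the absolute value
of the determinant of a square matrix. The vectors `v_k^n` are `v k : F^n`, `k = 0, …, N`, while the
vectors `v_k^N` are `w k : F^N`, `k = 1, …, N` (numbered from `0` here). -/
def AffineFormula (β : ℕ) {N : ℕ} (absDet : Matrix (Fin N) (Fin N) F → ℝ) (n : ℕ) : Prop :=
  -- Non-negative functions: equality in `[0, ∞]` of the integrals over all the vectors. The vector
  -- `v_0^N = c v_0^n` is any measurable function of `v_0^n`, in particular `B† v_0^n` with `B` a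
  -- fixed `n × N` matrix with orthonormal columns.
  (∀ f : PSD F N → ℝ≥0∞, AEMeasurable f (coneMeasure F N) →
    ∀ c : (Fin n → F) → (Fin N → F), Measurable c →
      ∫⁻ v : Fin (N + 1) → Fin n → F, f (gram (columns fun k => v k.succ - v 0)) =
        ENNReal.ofReal (grassmannVolume β n N) *
          ∫⁻ p : (Fin n → F) × (Fin N → Fin N → F),
            f (gram (columns fun k => p.2 k - c p.1)) *
              ENNReal.ofReal (absDet (columns fun k => p.2 k - c p.1) ^ (β * (n - N)))) ∧
  -- Real functions: absolute convergence and equality of the integrals over all the vectors, with an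
  -- arbitrary weight `φ` in the vector `v_0^n` (by translation invariance the integrals with
  -- `φ = 1` diverge unless `f` vanishes almost everywhere).
  (∀ f : PSD F N → ℝ, AEMeasurable f (coneMeasure F N) →
    ∀ c : (Fin n → F) → (Fin N → F), Measurable c →
    ∀ φ : (Fin n → F) → ℝ, Measurable φ →
      (Integrable (fun v : Fin (N + 1) → Fin n → F =>
          φ (v 0) * f (gram (columns fun k => v k.succ - v 0))) ↔
        Integrable (fun p : (Fin n → F) × (Fin N → Fin N → F) =>
          φ p.1 * (f (gram (columns fun k => p.2 k - c p.1)) *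
            absDet (columns fun k => p.2 k - c p.1) ^ (β * (n - N))))) ∧
      ∫ v : Fin (N + 1) → Fin n → F, φ (v 0) * f (gram (columns fun k => v k.succ - v 0)) =
        grassmannVolume β n N *
          ∫ p : (Fin n → F) × (Fin N → Fin N → F),
            φ p.1 * (f (gram (columns fun k => p.2 k - c p.1)) *
              absDet (columns fun k => p.2 k - c p.1) ^ (β * (n - N)))) ∧
  -- Real functions: absolute convergence and equality of the integrals over `v_1, …, v_N` for fixed
  -- `v_0^n = a` and `v_0^N = b`.
  (∀ f : PSD F N → ℝ, AEMeasurable f (coneMeasure F N) →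
    ∀ (a : Fin n → F) (b : Fin N → F),
      (Integrable (fun v : Fin N → Fin n → F => f (gram (columns fun k => v k - a))) ↔
        Integrable (fun w : Fin N → Fin N → F => f (gram (columns fun k => w k - b)) *
          absDet (columns fun k => w k - b) ^ (β * (n - N)))) ∧
      ∫ v : Fin N → Fin n → F, f (gram (columns fun k => v k - a)) =
        grassmannVolume β n N *
          ∫ w : Fin N → Fin N → F, f (gram (columns fun k => w k - b)) *
            absDet (columns fun k => w k - b) ^ (β * (n - N)))

end Formula

end AffineGram

end

noncomputable section

namespace AffineGram

set_option linter.unusedSectionVars false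

/-! The three formulas follow from one equality of measures on the cone (`map_gram`): the image of
Lebesgue measure on `n × N` matrices under `V ↦ V† V` is `C` times the image of the measure `|det
V|^(β(n-N)) dV` on `N × N` matrices.

This equality is proved by induction on `N` in `lintegral_gramEntries`. Gram matrices and `|det|`
are unitarily invariant, and so is Lebesgue measure, so the first column may be rotated to `(r, 0,
…, 0)` at the cost of `σ_{βn} r^(βn-1) dr` (`lintegral_of_unitary_invariant`). The other columns
become `(a_k, y_k)`, and the Gram matrix depends on the `y_k` only through their own Gram matrix, to
which the induction hypothesis applies. In the square case the determinant contributes `r^(β(n-N))`,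
which turns `r^(βN-1)` into `r^(βn-1)`. The radial integrals then agree and `σ_{βn} / σ_{βN}` is
left, one factor of `C`.

The affine statement follows by translation invariance: given `v_0`, the differences `v_k - v_0` are
again distributed by Lebesgue measure. -/

theorem algebraMap_mul_comm {F : Type} [NormedDivisionRing F] [NormedAlgebra ℝ F]
    (r : ℝ) (x : F) :
    x * algebraMap ℝ F r = algebraMap ℝ F r * x :=
  (Algebra.commutes r x).symm

/-! ### Householder reflections and unitary invariance of Lebesgue measure. -/

section Unitary

variable {F : Type} [NormedDivisionRing F] [NormedAlgebra ℝ F] [StarRing F] [StarNorm F]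

/-- A real `s ≥ 0` is `z̄ z` with `z = √s`, hence self-adjoint; negation covers the rest. -/
theorem star_algebraMap (r : ℝ) : star (algebraMap ℝ F r) = algebraMap ℝ F r := by
  have nonneg (s : ℝ) (hs : 0 ≤ s) : star (algebraMap ℝ F s) = algebraMap ℝ F s := by
    have h := StarNorm.star_mul_self' (algebraMap ℝ F (√s))
    rw [norm_algebraMap', Real.norm_eq_abs, sq_abs, Real.sq_sqrt hs] at h
    rw [← h, star_mul, star_star]
  rcases le_total 0 r with h | h
  · exact nonneg r h
  · have := nonneg (-r) (by linarith)
    simpa using this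

theorem sum_norm_sq_mulVec {m : ℕ} {U : Matrix (Fin m) (Fin m) F} (hU : Uᴴ * U = 1)
    (x : Fin m → F) : ∑ i, ‖(U *ᵥ x) i‖ ^ 2 = ∑ i, ‖x i‖ ^ 2 := by
  apply (algebraMap ℝ F).injective
  rw [← dot_star_self, ← dot_star_self, Matrix.star_mulVec, ← Matrix.dotProduct_mulVec,
    Matrix.mulVec_mulVec, hU, Matrix.one_mulVec]

/-- The Householder reflection sending a vector with real first entry to a multiple of the first
basis vector. -/
theorem exists_unitary_of_real {m : ℕ} (v : Fin (m + 1) → F) (t : ℝ)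
    (ht : v 0 = algebraMap ℝ F t) :
    ∃ U : Matrix (Fin (m + 1)) (Fin (m + 1)) F, Uᴴ * U = 1 ∧
      U *ᵥ v = Pi.single 0 (algebraMap ℝ F (√(∑ i, ‖v i‖ ^ 2))) := by
  set s := ∑ i, ‖v i‖ ^ 2 with hs
  have hs0 : 0 ≤ s := by positivity
  set r := √s with hr
  have hr2 : r * r = s := Real.mul_self_sqrt hs0
  set e : Fin (m + 1) → F := Pi.single 0 (algebraMap ℝ F r) with he
  by_cases huv : v = e
  · exact ⟨1, by simp, by simpa using huv⟩
  set u : Fin (m + 1) → F := v - e with hu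
  have hstar_e : star e = e := by
    ext i
    rcases eq_or_ne i 0 with rfl | hi
    · simp [he, star_algebraMap]
    · simp [he, hi]
  have hvv : star v ⬝ᵥ v = algebraMap ℝ F s := dot_star_self v
  have hve : star v ⬝ᵥ e = algebraMap ℝ F (t * r) := by
    simp [he, ht, star_algebraMap]
  have hev : star e ⬝ᵥ v = algebraMap ℝ F (t * r) := by
    rw [hstar_e]; simp [he, ht, mul_comm t r]
  have hee : star e ⬝ᵥ e = algebraMap ℝ F s := by
    rw [hstar_e, ← hr2]; simp [he]
  have huu : star u ⬝ᵥ u = algebraMap ℝ F (2 * (s - t * r)) := by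
    rw [hu, star_sub, sub_dotProduct, dotProduct_sub, dotProduct_sub, hvv, hve, hev, hee,
      ← map_sub, ← map_sub, ← map_sub]
    congr 1; ring
  have huv' : star u ⬝ᵥ v = algebraMap ℝ F (s - t * r) := by
    rw [hu, star_sub, sub_dotProduct, hvv, hev, ← map_sub]
  -- By `huu` this number is half of `∑ ‖u i‖ ^ 2`, so it vanishes only if `v = e`.
  have hpos : s - t * r ≠ 0 := by
    intro h0
    rw [h0, mul_zero, dot_star_self] at huu
    have h1 : ∑ i, ‖u i‖ ^ 2 = 0 := (algebraMap ℝ F).injective huu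
    rw [Finset.sum_eq_zero_iff_of_nonneg (fun i _ => by positivity)] at h1
    apply huv
    rw [← sub_eq_zero]
    ext i
    change u i = 0
    simpa only [ne_eq, OfNat.ofNat_ne_zero, not_false_eq_true, pow_eq_zero_iff, norm_eq_zero] using
      h1 i (Finset.mem_univ i)
  set q := s - t * r with hq
  have hP : Matrix.vecMulVec u (star u) * Matrix.vecMulVec u (star u) =
      (2 * q) • Matrix.vecMulVec u (star u) := by
    rw [Matrix.vecMulVec_mul_vecMulVec, huu]
    ext i j
    simp only [Matrix.vecMulVec_apply, Matrix.smul_apply, Algebra.smul_def, Pi.smul_apply,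
      smul_eq_mul, ← mul_assoc, algebraMap_mul_comm]
  have hPs : (Matrix.vecMulVec u (star u))ᴴ = Matrix.vecMulVec u (star u) := by
    rw [Matrix.conjTranspose_vecMulVec, star_star]
  -- Since `u† u = 2q`, this is the reflection in the hyperplane orthogonal to `u`. As `u† v = q`,
  -- it sends `v` to `v - u = e`. Both values are real because the first entry of `v` is.
  refine ⟨1 - q⁻¹ • Matrix.vecMulVec u (star u), ?_, ?_⟩
  · have hH : (1 - q⁻¹ • Matrix.vecMulVec u (star u))ᴴ =
        1 - q⁻¹ • Matrix.vecMulVec u (star u) := by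
      rw [Matrix.conjTranspose_sub, Matrix.conjTranspose_one]
      congr 1
      conv_rhs => rw [← hPs]
      ext i j
      rw [Matrix.conjTranspose_apply, Matrix.smul_apply, Matrix.smul_apply,
        Matrix.conjTranspose_apply, Algebra.smul_def, Algebra.smul_def, star_mul, star_algebraMap,
        algebraMap_mul_comm]
    rw [hH, sub_mul, mul_sub, mul_sub, one_mul, one_mul, mul_one, smul_mul_assoc, mul_smul_comm,
      hP, smul_smul, smul_smul]
    have : q⁻¹ * q⁻¹ * (2 * q) = q⁻¹ + q⁻¹ := by field_simp; norm_num
    rw [this, add_smul]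
    abel
  · rw [Matrix.sub_mulVec, Matrix.one_mulVec, Matrix.smul_mulVec, Matrix.vecMulVec_mulVec, huv']
    have : q⁻¹ • (MulOpposite.op (algebraMap ℝ F q) • u) = u := by
      ext i
      change q⁻¹ • (u i * algebraMap ℝ F q) = u i
      rw [algebraMap_mul_comm, ← Algebra.smul_def, smul_smul, inv_mul_cancel₀ hpos, one_smul]
    rw [this, hu]; abel

/-- Left multiplication of all entries by one unit scalar makes the first entry real; a reflection
does the rest. -/
theorem exists_unitary {m : ℕ} (v : Fin (m + 1) → F) :
    ∃ U : Matrix (Fin (m + 1)) (Fin (m + 1)) F, Uᴴ * U = 1 ∧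
      U *ᵥ v = Pi.single 0 (algebraMap ℝ F (√(∑ i, ‖v i‖ ^ 2))) := by
  obtain ⟨q, t, hq, hqt⟩ : ∃ (q : F) (t : ℝ), star q * q = 1 ∧ q * v 0 = algebraMap ℝ F t := by
    by_cases h0 : v 0 = 0
    · exact ⟨1, 0, by simp, by simp [h0]⟩
    · have hn : ‖v 0‖ ≠ 0 := by simpa using h0
      have key : star (v 0) * v 0 = algebraMap ℝ F (‖v 0‖ ^ 2) := StarNorm.star_mul_self' _
      have key' : v 0 * star (v 0) = algebraMap ℝ F (‖v 0‖ ^ 2) := by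
        apply mul_right_cancel₀ h0
        rw [mul_assoc, key, algebraMap_mul_comm]
      refine ⟨algebraMap ℝ F ‖v 0‖⁻¹ * star (v 0), ‖v 0‖, ?_, ?_⟩
      · rw [star_mul, star_star, star_algebraMap, mul_assoc, ← mul_assoc (algebraMap ℝ F _),
          ← map_mul, ← mul_assoc, algebraMap_mul_comm, mul_assoc, key', ← map_mul]
        rw [← map_one (algebraMap ℝ F)]
        congr 1; field_simp
      · rw [mul_assoc, key, ← map_mul]
        congr 1; field_simp
  have hD : (Matrix.diagonal fun _ : Fin (m + 1) => q)ᴴ * Matrix.diagonal (fun _ => q) = 1 := by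
    rw [Matrix.diagonal_conjTranspose, Matrix.diagonal_mul_diagonal]
    simp only [Pi.star_apply, hq]
    exact Matrix.diagonal_one
  have hnorm := sum_norm_sq_mulVec hD v
  obtain ⟨U, hU, hUv⟩ := exists_unitary_of_real (Matrix.diagonal (fun _ => q) *ᵥ v) t
    (by rw [Matrix.mulVec_diagonal]; exact hqt)
  refine ⟨U * Matrix.diagonal fun _ => q, ?_, ?_⟩
  · rw [Matrix.conjTranspose_mul, Matrix.mul_assoc, ← Matrix.mul_assoc Uᴴ, hU, Matrix.one_mul, hD]
  · rw [← Matrix.mulVec_mulVec, hUv, hnorm]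

variable [MeasureSpace F] [BorelSpace F] [FiniteDimensional ℝ F] [SecondCountableTopology F]
  [(volume : Measure F).IsAddHaarMeasure]

/-- As a real linear map, `U` scales volume by a constant. The constant is `1` because the Euclidean
unit ball is mapped to itself and has finite positive volume. -/
theorem measurePreserving_mulVec {m : ℕ} {U : Matrix (Fin m) (Fin m) F} (hU : Uᴴ * U = 1) :
    MeasurePreserving (fun x : Fin m → F => U *ᵥ x) := by
  let L : (Fin m → F) →ₗ[ℝ] (Fin m → F) :=
    { toFun := fun x => U *ᵥ x
      map_add' := Matrix.mulVec_add U
      map_smul' := fun c x => Matrix.mulVec_smul U c x }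
  have hinj : Function.Injective L := by
    intro x y hxy
    have : Uᴴ *ᵥ (U *ᵥ x) = Uᴴ *ᵥ (U *ᵥ y) := congrArg _ hxy
    simpa [hU] using this
  have hdet : LinearMap.det L ≠ 0 := by
    have := (LinearEquiv.ofInjectiveEndo L hinj).isUnit_det'
    exact this.ne_zero
  let B : Set (Fin m → F) := {x | ∑ i, ‖x i‖ ^ 2 < 1}
  have hopen : IsOpen B := isOpen_lt (by fun_prop) continuous_const
  have hB0 : volume B ≠ 0 := (hopen.measure_pos volume ⟨0, by simp [B]⟩).ne'
  have hBtop : volume B ≠ ∞ := by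
    refine (measure_mono (t := Metric.closedBall 0 1) ?_).trans_lt
      (measure_closedBall_lt_top) |>.ne
    intro x hx
    rw [mem_closedBall_zero_iff, pi_norm_le_iff_of_nonneg zero_le_one]
    intro i
    have : ‖x i‖ ^ 2 ≤ ∑ j, ‖x j‖ ^ 2 :=
      Finset.single_le_sum (f := fun j => ‖x j‖ ^ 2) (fun j _ => by positivity) (Finset.mem_univ i)
    have hx' : ∑ i, ‖x i‖ ^ 2 < 1 := hx
    nlinarith [norm_nonneg (x i)]
  have hpre : L ⁻¹' B = B := by
    ext x
    change ∑ i, ‖(U *ᵥ x) i‖ ^ 2 < 1 ↔ ∑ i, ‖x i‖ ^ 2 < 1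
    rw [sum_norm_sq_mulVec hU]
  have h1 := Measure.addHaar_preimage_linearMap (volume : Measure (Fin m → F)) hdet B
  rw [hpre] at h1
  have h2 : ENNReal.ofReal |(LinearMap.det L)⁻¹| = 1 := by
    rwa [eq_comm, ENNReal.mul_eq_right hB0 hBtop] at h1
  have h3 := Measure.map_linearMap_addHaar_eq_smul_addHaar (volume : Measure (Fin m → F)) hdet
  rw [h2, one_smul] at h3
  exact ⟨(LinearMap.continuous_of_finiteDimensional L).measurable, h3⟩

end Unitary

/-! ### Polar coordinates. -/

theorem lintegral_fun_norm_addHaar {E : Type*} [NormedAddCommGroup E] [NormedSpace ℝ E]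
    [Nontrivial E] [FiniteDimensional ℝ E] [MeasurableSpace E] [BorelSpace E] (μ : Measure E)
    [μ.IsAddHaarMeasure] {G : ℝ → ℝ≥0∞} (hG : Measurable G) :
    ∫⁻ x, G ‖x‖ ∂μ = Module.finrank ℝ E * μ (Metric.ball 0 1) *
      ∫⁻ r in Set.Ioi (0 : ℝ), ENNReal.ofReal (r ^ (Module.finrank ℝ E - 1)) * G r := by
  have h := μ.measurePreserving_homeomorphUnitSphereProd.lintegral_comp_emb
    (Homeomorph.measurableEmbedding _) (fun p => G p.2)
  simp only [homeomorphUnitSphereProd_apply_snd_coe] at h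
  rw [lintegral_subtype_comap (measurableSet_singleton _).compl (fun x => G ‖x‖),
    restrict_compl_singleton, lintegral_prod _ (by fun_prop)] at h
  simp only at h
  rw [lintegral_const, Measure.toSphere_apply_univ, Measure.volumeIoiPow,
    lintegral_withDensity_eq_lintegral_mul _ (by fun_prop) (by fun_prop)] at h
  rw [h, mul_comm, ← lintegral_subtype_comap measurableSet_Ioi]
  rfl

theorem ball_eq_sphereArea {d : ℕ} (hd : 0 < d) :
    (d : ℝ≥0∞) * ENNReal.ofReal (Real.pi ^ ((d : ℝ) / 2) / Real.Gamma ((d : ℝ) / 2 + 1)) =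
      ENNReal.ofReal (sphereArea d) := by
  have hd' : (0 : ℝ) < d := by exact_mod_cast hd
  rw [← ENNReal.ofReal_natCast, ← ENNReal.ofReal_mul (by positivity), sphereArea,
    Real.Gamma_add_one (by positivity)]
  congr 1
  field_simp

theorem sphereArea_pos {d : ℕ} (hd : 0 < d) : 0 < sphereArea d := by
  have hd' : (0 : ℝ) < d := by exact_mod_cast hd
  have := Real.Gamma_pos_of_pos (half_pos hd')
  unfold sphereArea
  positivity

section Polar

variable {F : Type} [NormedDivisionRing F] [NormedAlgebra ℝ F]
  [MeasureSpace F] [BorelSpace F] [FiniteDimensional ℝ F] [SecondCountableTopology F]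
  [(volume : Measure F).IsAddHaarMeasure]

/-- The function space carries the sup norm, so the measure is transported to the `L²` product,
where the polar formula applies. The volume of the unit ball is read off from the Gaussian integral,
which factors over the coordinates. -/
theorem lintegral_norm_pi {β : ℕ} (hβ : Module.finrank ℝ F = β)
    (hgauss : ∫ x : F, Real.exp (-‖x‖ ^ 2) = Real.pi ^ ((β : ℝ) / 2))
    (m : ℕ) {G : ℝ → ℝ≥0∞} (hG : Measurable G) :
    ∫⁻ x : Fin (m + 1) → F, G (√(∑ i, ‖x i‖ ^ 2)) =
      ENNReal.ofReal (sphereArea (β * (m + 1))) *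
        ∫⁻ r in Set.Ioi (0 : ℝ), ENNReal.ofReal (r ^ (β * (m + 1) - 1)) * G r := by
  let E := PiLp 2 (fun _ : Fin (m + 1) => F)
  let e : (Fin (m + 1) → F) ≃L[ℝ] E := (PiLp.continuousLinearEquiv 2 ℝ _).symm
  let μ : Measure E := volume.map e
  have : μ.IsAddHaarMeasure := e.isAddHaarMeasure_map volume
  have hnorm (x : Fin (m + 1) → F) : ‖e x‖ = √(∑ i, ‖x i‖ ^ 2) := PiLp.norm_eq_of_L2 _
  have hd : Module.finrank ℝ E = β * (m + 1) := by
    rw [← e.toLinearEquiv.finrank_eq, Module.finrank_pi_fintype]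
    simp [hβ, mul_comm]
  have hβ0 : 0 < β := hβ ▸ Module.finrank_pos
  have hd0 : 0 < β * (m + 1) := by positivity
  have : Nontrivial E := Module.nontrivial_of_finrank_pos (R := ℝ) (hd ▸ hd0)
  have hint : ∫ x, Real.exp (-‖x‖ ^ (2 : ℝ)) ∂μ = Real.pi ^ (((β * (m + 1) : ℕ) : ℝ) / 2) := by
    have he : MeasurableEmbedding e := e.toHomeomorph.measurableEmbedding
    rw [he.integral_map]
    have (x : Fin (m + 1) → F) : Real.exp (-‖e x‖ ^ (2 : ℝ)) = ∏ i, Real.exp (-‖x i‖ ^ 2) := by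
      rw [hnorm, Real.rpow_two, Real.sq_sqrt (by positivity), ← Real.exp_sum,
        Finset.sum_neg_distrib]
    change ∫ x, Real.exp (-‖e x‖ ^ (2 : ℝ)) = _
    simp_rw [this]
    rw [integral_fintype_prod_volume_eq_pow (fun y : F => Real.exp (-‖y‖ ^ 2)), hgauss,
      ← Real.rpow_mul_natCast Real.pi_pos.le]
    congr 1
    simp; ring
  have hball : (β * (m + 1) : ℕ) * μ (Metric.ball 0 1) =
      ENNReal.ofReal (sphereArea (β * (m + 1))) := by
    rw [measure_unitBall_eq_integral_div_gamma μ (p := 2) two_pos, hint, hd, ball_eq_sphereArea hd0]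
  have h := lintegral_fun_norm_addHaar μ hG
  rw [hd, hball, lintegral_map (by fun_prop) e.continuous.measurable] at h
  simpa only [hnorm] using h

end Polar

/-! ### Splitting off the first vector and the first coordinates. -/

section Peel

variable {F : Type} [NormedDivisionRing F] [NormedAlgebra ℝ F] [StarRing F] [StarNorm F]
  [MeasureSpace F] [BorelSpace F] [FiniteDimensional ℝ F] [SecondCountableTopology F]
  [(volume : Measure F).IsAddHaarMeasure]

theorem piFinSuccAbove_symm_eq_cons {X : Type} [MeasurableSpace X] {N : ℕ}
    (p : X × (Fin N → X)) :
    (MeasurableEquiv.piFinSuccAbove (fun _ : Fin (N + 1) => X) 0).symm p = Fin.cons p.1 p.2 :=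
  Fin.insertNth_zero' p.1 p.2

theorem measurable_fin_cons {X : Type} [MeasurableSpace X] {N : ℕ} :
    Measurable fun p : X × (Fin N → X) => (Fin.cons p.1 p.2 : Fin (N + 1) → X) := by
  simp_rw [← piFinSuccAbove_symm_eq_cons]
  exact MeasurableEquiv.measurable _

theorem measurePreserving_fin_cons {X : Type} [MeasureSpace X] [SigmaFinite (volume : Measure X)]
    {N : ℕ} :
    MeasurePreserving fun p : X × (Fin N → X) => (Fin.cons p.1 p.2 : Fin (N + 1) → X) := by
  simp_rw [← piFinSuccAbove_symm_eq_cons]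
  exact (volume_preserving_piFinSuccAbove (fun _ : Fin (N + 1) => X) 0).symm

theorem lintegral_fin_cons {X : Type} [MeasureSpace X] [SigmaFinite (volume : Measure X)] {N : ℕ}
    {h : (Fin (N + 1) → X) → ℝ≥0∞} (hm : Measurable h) :
    ∫⁻ z, h z = ∫⁻ v : X, ∫⁻ y : Fin N → X, h (Fin.cons v y) := by
  rw [← measurePreserving_fin_cons.lintegral_comp hm, Measure.volume_eq_prod]
  exact lintegral_prod _ (hm.comp measurable_fin_cons).aemeasurable

theorem lintegral_pi_fin_cons {X : Type} [MeasureSpace X] [SigmaFinite (volume : Measure X)]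
    {N m : ℕ} {h : (Fin N → Fin (m + 1) → X) → ℝ≥0∞} (hm : Measurable h) :
    ∫⁻ z, h z = ∫⁻ a : Fin N → X, ∫⁻ y : Fin N → Fin m → X,
      h (fun k => Fin.cons (a k) (y k)) := by
  have e1 := volume_preserving_pi (fun _ : Fin N =>
    measurePreserving_fin_cons (X := X) (N := m))
  have e2 := (volume_measurePreserving_arrowProdEquivProdArrow X (Fin m → X) (Fin N)).symm
  have e := e1.comp e2
  rw [← e.lintegral_comp hm, Measure.volume_eq_prod]
  exact lintegral_prod _ (hm.comp e.measurable).aemeasurable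

/-- Integration of a unitarily invariant function of `N + 1` vectors: the first vector may be
rotated to a multiple of the first basis vector. -/
theorem lintegral_of_unitary_invariant {β : ℕ} (hβ : Module.finrank ℝ F = β)
    (hgauss : ∫ x : F, Real.exp (-‖x‖ ^ 2) = Real.pi ^ ((β : ℝ) / 2)) {N m : ℕ}
    {h : (Fin (N + 1) → Fin (m + 1) → F) → ℝ≥0∞} (hm : Measurable h)
    (hU : ∀ U : Matrix (Fin (m + 1)) (Fin (m + 1)) F, Uᴴ * U = 1 → ∀ z,
      h (fun k => U *ᵥ z k) = h z) :
    ∫⁻ z, h z = ENNReal.ofReal (sphereArea (β * (m + 1))) *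
      ∫⁻ r in Set.Ioi (0 : ℝ), ENNReal.ofReal (r ^ (β * (m + 1) - 1)) *
        ∫⁻ a : Fin N → F, ∫⁻ y : Fin N → Fin m → F,
          h (Fin.cons (Pi.single 0 (algebraMap ℝ F r)) (fun k => Fin.cons (a k) (y k))) := by
  -- Rotating the remaining vectors along with `v` preserves their measure, so `A v` depends only on
  -- the Euclidean length of `v`.
  let A (v : Fin (m + 1) → F) : ℝ≥0∞ := ∫⁻ z : Fin N → Fin (m + 1) → F, h (Fin.cons v z)
  have hcons : Measurable fun p : (Fin (m + 1) → F) × (Fin N → Fin (m + 1) → F) =>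
      h (Fin.cons p.1 p.2) :=
    hm.comp measurable_fin_cons
  have hA : Measurable A := hcons.lintegral_prod_right'
  have hAU (U : Matrix (Fin (m + 1)) (Fin (m + 1)) F) (h1 : Uᴴ * U = 1) (v) :
      A (U *ᵥ v) = A v := by
    have e := volume_preserving_pi (fun _ : Fin N => measurePreserving_mulVec h1)
    have hm1 : Measurable fun z : Fin N → Fin (m + 1) → F => h (Fin.cons (U *ᵥ v) z) :=
      hcons.comp measurable_prodMk_left
    simp only [A]
    rw [← e.lintegral_comp hm1]
    refine lintegral_congr fun z => ?_
    rw [← hU U h1 (Fin.cons v z)]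
    congr 1
    ext k : 1
    refine Fin.cases ?_ (fun k => ?_) k <;> simp
  let s (r : ℝ) : Fin (m + 1) → F := Pi.single 0 (algebraMap ℝ F r)
  have hs : Measurable s := by
    have : Continuous s := (continuous_single 0).comp (continuous_algebraMap ℝ F)
    exact this.measurable
  rw [lintegral_fin_cons hm]
  calc ∫⁻ v, A v = ∫⁻ v : Fin (m + 1) → F, A (s (√(∑ i, ‖v i‖ ^ 2))) := by
        refine lintegral_congr fun v => ?_
        obtain ⟨U, h1, h2⟩ := exists_unitary v
        rw [← hAU U h1 v, h2]
    _ = _ := by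
        rw [lintegral_norm_pi hβ hgauss m (G := fun r => A (s r)) (hA.comp hs)]
        congr 1
        refine lintegral_congr fun r => ?_
        congr 1
        exact lintegral_pi_fin_cons (hcons.comp measurable_prodMk_left)

end Peel

/-! ### The constant, and the induction on the number of vectors. -/

theorem grassmannVolume_pos {β : ℕ} (hβ : 0 < β) (n N : ℕ) : 0 < grassmannVolume β n N := by
  refine Finset.prod_pos fun i _ => div_pos (sphereArea_pos ?_) (sphereArea_pos ?_) <;> positivity

theorem grassmannVolume_succ_succ (β : ℕ) (n N : ℕ) :
    grassmannVolume β (n + 1) (N + 1) =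
      sphereArea (β * (n + 1)) / sphereArea (β * (N + 1)) * grassmannVolume β n N := by
  unfold grassmannVolume
  have shift (g : ℕ → ℝ) (M : ℕ) :
      ∏ i ∈ Finset.Icc 1 (M + 1), g i = g 1 * ∏ i ∈ Finset.Icc 1 M, g (i + 1) := by
    induction M with
    | zero => simp
    | succ M ih => rw [Finset.prod_Icc_succ_top (by lia), ih, Finset.prod_Icc_succ_top (by lia),
        mul_assoc]
  rw [shift]
  congr 1
  refine Finset.prod_congr rfl fun i hi => ?_
  rw [Nat.add_sub_add_right, Nat.add_sub_add_right]

section Core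

variable (F : Type) [NormedDivisionRing F] [NormedAlgebra ℝ F] [StarRing F] [StarNorm F]
  [MeasureSpace F]

/-- The properties of the absolute value of the determinant used in the integration formula. -/
structure IsAbsDet (D : ∀ N : ℕ, Matrix (Fin N) (Fin N) F → ℝ) : Prop where
  measurable : ∀ N, Measurable fun z : Fin N → Fin N → F => D N (columns z)
  nonneg : ∀ N M, 0 ≤ D N M
  of_zero : ∀ M, D 0 M = 1
  unitary_mul : ∀ (N : ℕ) (U M : Matrix (Fin N) (Fin N) F), Uᴴ * U = 1 → D N (U * M) = D N M
  cons : ∀ (N : ℕ) (r : ℝ) (a : Fin N → F) (y : Fin N → Fin N → F), 0 < r →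
    D (N + 1) (columns (Fin.cons (Pi.single 0 (algebraMap ℝ F r)) fun k => Fin.cons (a k) (y k))) =
      r * D N (columns y)

variable {F}

/-- The entries of the Gram matrix of the vectors `z 0, …, z (N - 1)`. -/
def gramEntries {m N : ℕ} (z : Fin N → Fin m → F) (i j : Fin N) : F :=
  ∑ k, star (z i k) * z j k

theorem conjTranspose_columns_mul_columns {m N : ℕ} (z : Fin N → Fin m → F) (i j : Fin N) :
    ((columns z)ᴴ * columns z) i j = gramEntries z i j := rfl

theorem columns_mulVec {m N : ℕ} (U : Matrix (Fin m) (Fin m) F) (z : Fin N → Fin m → F) :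
    columns (fun k => U *ᵥ z k) = U * columns z := rfl

theorem gramEntries_mulVec {m N : ℕ} {U : Matrix (Fin m) (Fin m) F} (hU : Uᴴ * U = 1)
    (z : Fin N → Fin m → F) : gramEntries (fun k => U *ᵥ z k) = gramEntries z := by
  ext i j
  rw [← conjTranspose_columns_mul_columns, columns_mulVec, Matrix.conjTranspose_mul,
    Matrix.mul_assoc, ← Matrix.mul_assoc Uᴴ, hU, Matrix.one_mul,
    conjTranspose_columns_mul_columns]

/-- The Gram matrix of `(r, 0)` and the vectors `(a k, y k)`, as a function of the Gram matrix `W`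
of the vectors `y k`. -/
def borderedGram {N : ℕ} (r : ℝ) (a : Fin N → F) (W : Fin N → Fin N → F) :
    Fin (N + 1) → Fin (N + 1) → F :=
  Fin.cons (Fin.cons (algebraMap ℝ F r * algebraMap ℝ F r) fun j => algebraMap ℝ F r * a j)
    fun i => Fin.cons (star (a i) * algebraMap ℝ F r) fun j => star (a i) * a j + W i j

theorem gramEntries_cons {m N : ℕ} (r : ℝ) (a : Fin N → F) (y : Fin N → Fin m → F) :
    gramEntries (Fin.cons (Pi.single 0 (algebraMap ℝ F r)) fun k => Fin.cons (a k) (y k)) =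
      borderedGram r a (gramEntries y) := by
  ext i j
  refine Fin.cases ?_ (fun i => ?_) i <;> refine Fin.cases ?_ (fun j => ?_) j <;>
    simp [gramEntries, borderedGram, Fin.sum_univ_succ, star_algebraMap]

variable [BorelSpace F] [SecondCountableTopology F]

theorem measurable_borderedGram {N : ℕ} (r : ℝ) (a : Fin N → F) :
    Measurable (borderedGram r a) := by
  refine measurable_pi_iff.2 fun i => measurable_pi_iff.2 fun j => ?_
  refine Fin.cases ?_ (fun i => ?_) i <;> refine Fin.cases ?_ (fun j => ?_) j <;>
    simp only [borderedGram, Fin.cons_zero, Fin.cons_succ] <;> fun_prop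

variable [ContinuousStar F]

theorem measurable_gramEntries {m N : ℕ} :
    Measurable fun z : Fin N → Fin m → F => gramEntries z := by
  have : Continuous fun z : Fin N → Fin m → F => gramEntries z := by
    unfold gramEntries; fun_prop
  exact this.measurable

variable [FiniteDimensional ℝ F] [(volume : Measure F).IsAddHaarMeasure]

/-- The induction must allow all `n` and `f`: the inductive step uses the hypothesis for vectors
with one coordinate fewer and for `f ∘ borderedGram r a`. -/
theorem lintegral_gramEntries {β : ℕ} (hβ : Module.finrank ℝ F = β)
    (hgauss : ∫ x : F, Real.exp (-‖x‖ ^ 2) = Real.pi ^ ((β : ℝ) / 2))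
    {D : ∀ N : ℕ, Matrix (Fin N) (Fin N) F → ℝ} (hD : IsAbsDet F D) {n N : ℕ} (hN : N ≤ n)
    {f : (Fin N → Fin N → F) → ℝ≥0∞} (hf : Measurable f) :
    ∫⁻ z : Fin N → Fin n → F, f (gramEntries z) =
      ENNReal.ofReal (grassmannVolume β n N) * ∫⁻ z : Fin N → Fin N → F,
        f (gramEntries z) * ENNReal.ofReal (D N (columns z) ^ (β * (n - N))) := by
  have hβ0 : 0 < β := hβ ▸ Module.finrank_pos
  induction N generalizing n with
  | zero =>
    -- With no vectors, both integrals run over a one-point space of mass `1`.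
    have h (m : ℕ) (z : Fin 0 → Fin m → F) : f (gramEntries z) = f isEmptyElim :=
      congrArg f (Subsingleton.elim _ _)
    simp only [h, hD.of_zero, lintegral_const]
    rw [Measure.volume_pi_eq_dirac (α := fun _ : Fin 0 => Fin n → F),
      Measure.volume_pi_eq_dirac (α := fun _ : Fin 0 => Fin 0 → F)]
    simp [grassmannVolume]
  | succ N ih =>
    obtain ⟨n, rfl⟩ : ∃ m, n = m + 1 := ⟨n - 1, by lia⟩
    have hNn : N ≤ n := by lia
    have hdens : Measurable fun z : Fin (N + 1) → Fin (N + 1) → F => f (gramEntries z) *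
        ENNReal.ofReal (D (N + 1) (columns z) ^ (β * (n + 1 - (N + 1)))) :=
      (hf.comp measurable_gramEntries).mul ((hD.measurable _).pow_const _).ennreal_ofReal
    rw [lintegral_of_unitary_invariant hβ hgauss (h := fun z => f (gramEntries z))
        (hf.comp measurable_gramEntries)
        fun U hU z => by simp only [gramEntries_mulVec hU],
      lintegral_of_unitary_invariant hβ hgauss hdens
        fun U hU z => by simp only [gramEntries_mulVec hU, columns_mulVec, hD.unitary_mul _ U _ hU]]
    simp only [gramEntries_cons]
    have step (r : ℝ) (a : Fin N → F) :
        ∫⁻ y : Fin N → Fin n → F, f (borderedGram r a (gramEntries y)) =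
          ENNReal.ofReal (grassmannVolume β n N) * ∫⁻ z : Fin N → Fin N → F,
            f (borderedGram r a (gramEntries z)) *
              ENNReal.ofReal (D N (columns z) ^ (β * (n - N))) :=
      ih hNn (hf.comp (measurable_borderedGram r a))
    simp only [step]
    set g : ℝ → ℝ≥0∞ := fun r => ∫⁻ a : Fin N → F, ∫⁻ z : Fin N → Fin N → F,
            f (borderedGram r a (gramEntries z)) *
              ENNReal.ofReal (D N (columns z) ^ (β * (n - N))) with hg
    have e1 : ∫⁻ r in Set.Ioi (0 : ℝ), ENNReal.ofReal (r ^ (β * (n + 1) - 1)) *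
          ∫⁻ a : Fin N → F, ENNReal.ofReal (grassmannVolume β n N) * ∫⁻ z : Fin N → Fin N → F,
            f (borderedGram r a (gramEntries z)) *
              ENNReal.ofReal (D N (columns z) ^ (β * (n - N))) =
        ENNReal.ofReal (grassmannVolume β n N) *
          ∫⁻ r in Set.Ioi (0 : ℝ), ENNReal.ofReal (r ^ (β * (n + 1) - 1)) * g r := by
      rw [← lintegral_const_mul' _ _ ENNReal.ofReal_ne_top]
      refine lintegral_congr fun r => ?_
      rw [lintegral_const_mul' _ _ ENNReal.ofReal_ne_top, mul_left_comm]
    have e2 : ∫⁻ r in Set.Ioi (0 : ℝ), ENNReal.ofReal (r ^ (β * (N + 1) - 1)) *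
          ∫⁻ a : Fin N → F, ∫⁻ y : Fin N → Fin N → F, f (borderedGram r a (gramEntries y)) *
            ENNReal.ofReal (D (N + 1) (columns (Fin.cons (Pi.single 0 (algebraMap ℝ F r))
              fun k => Fin.cons (a k) (y k))) ^ (β * (n + 1 - (N + 1)))) =
        ∫⁻ r in Set.Ioi (0 : ℝ), ENNReal.ofReal (r ^ (β * (n + 1) - 1)) * g r := by
      -- The determinant supplies `r ^ (β * (n - N))`, exactly the gap between the radial exponents
      -- in dimensions `β(N + 1)` and `β(n + 1)`.
      refine setLIntegral_congr_fun measurableSet_Ioi fun r (hr : 0 < r) => ?_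
      have e3 (a : Fin N → F) (y : Fin N → Fin N → F) :
          f (borderedGram r a (gramEntries y)) *
            ENNReal.ofReal (D (N + 1) (columns (Fin.cons (Pi.single 0 (algebraMap ℝ F r))
              fun k => Fin.cons (a k) (y k))) ^ (β * (n + 1 - (N + 1)))) =
          ENNReal.ofReal (r ^ (β * (n - N))) * (f (borderedGram r a (gramEntries y)) *
              ENNReal.ofReal (D N (columns y) ^ (β * (n - N)))) := by
        rw [hD.cons _ _ _ _ hr, mul_pow, ENNReal.ofReal_mul (by positivity), mul_left_comm,
          Nat.add_sub_add_right]
      simp only [e3]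
      simp_rw [lintegral_const_mul' _ _ ENNReal.ofReal_ne_top]
      rw [← mul_assoc, ← ENNReal.ofReal_mul (by positivity), ← pow_add]
      congr 4
      obtain ⟨d, rfl⟩ := Nat.exists_eq_add_of_le hNn
      rw [Nat.add_sub_cancel_left]
      have : 0 < β * (N + 1) := by positivity
      have : β * (N + d + 1) = β * (N + 1) + β * d := by ring
      lia
    rw [e1, e2, grassmannVolume_succ_succ β n N, ← mul_assoc, ← mul_assoc]
    have p1 : 0 < sphereArea (β * (N + 1)) := sphereArea_pos (by positivity)
    have p2 : 0 < sphereArea (β * (n + 1)) := sphereArea_pos (by positivity)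
    have p3 := grassmannVolume_pos hβ0 n N
    rw [← ENNReal.ofReal_mul p2.le, ← ENNReal.ofReal_mul (by positivity)]
    congr 2
    field_simp

end Core

/-! ### Transport of integrals through an equality of image measures. -/

theorem map_withDensity_comp {X Y : Type*} [MeasurableSpace X] [MeasurableSpace Y]
    {μ : Measure X} {ν : Measure Y} {s : X → Y} (hs : MeasurePreserving s μ ν) {d : Y → ℝ≥0∞}
    (hd : Measurable d) : (μ.withDensity fun x => d (s x)).map s = ν.withDensity d := by
  ext S hS
  rw [Measure.map_apply hs.measurable hS, withDensity_apply _ (hs.measurable hS),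
    withDensity_apply _ hS, ← hs.setLIntegral_comp_preimage hS hd]

section Transport

variable {X Y P : Type*} [MeasurableSpace X] [MeasurableSpace Y] [MeasurableSpace P]
  {μ : Measure X} {ν : Measure Y} {S : X → P} {T : Y → P} {δ : Y → ℝ} {C : ℝ}

theorem lintegral_comp_eq_of_map_eq (hS : Measurable S) (hT : Measurable T) (hδ : Measurable δ)
    (h : μ.map S = ENNReal.ofReal C • (ν.withDensity fun y => ENNReal.ofReal (δ y)).map T)
    {g : P → ℝ≥0∞} (hg : AEMeasurable g (μ.map S))
    (hg' : AEMeasurable g ((ν.withDensity fun y => ENNReal.ofReal (δ y)).map T)) :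
    ∫⁻ x, g (S x) ∂μ = ENNReal.ofReal C * ∫⁻ y, g (T y) * ENNReal.ofReal (δ y) ∂ν := by
  rw [← lintegral_map' hg hS.aemeasurable, h, lintegral_smul_measure,
    lintegral_map' hg' hT.aemeasurable, smul_eq_mul]
  congr 1
  refine (lintegral_withDensity_eq_lintegral_mul₀' hδ.ennreal_ofReal.aemeasurable
    (hg'.comp_measurable hT)).trans (lintegral_congr fun y => mul_comm _ _)

/-- Both sides are integrals of `g` over the same measure on `P`; the factor `C` is finite and
nonzero, so it does not affect integrability. -/
theorem integral_comp_eq_of_map_eq (hS : Measurable S) (hT : Measurable T) (hδ : Measurable δ)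
    (hδ0 : ∀ y, 0 ≤ δ y) (hC : 0 < C)
    (h : μ.map S = ENNReal.ofReal C • (ν.withDensity fun y => ENNReal.ofReal (δ y)).map T)
    {g : P → ℝ} (hg : AEMeasurable g (μ.map S))
    (hg' : AEMeasurable g ((ν.withDensity fun y => ENNReal.ofReal (δ y)).map T)) :
    (Integrable (fun x => g (S x)) μ ↔ Integrable (fun y => g (T y) * δ y) ν) ∧
      ∫ x, g (S x) ∂μ = C * ∫ y, g (T y) * δ y ∂ν := by
  have hsmul (y : Y) : (ENNReal.ofReal (δ y)).toReal • g (T y) = g (T y) * δ y := by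
    rw [ENNReal.toReal_ofReal (hδ0 y), smul_eq_mul, mul_comm]
  constructor
  · rw [← Function.comp_def g S, ← integrable_map_measure hg.aestronglyMeasurable hS.aemeasurable,
      h, integrable_smul_measure (by simpa using hC) ENNReal.ofReal_ne_top,
      integrable_map_measure hg'.aestronglyMeasurable hT.aemeasurable,
      integrable_withDensity_iff_integrable_smul' hδ.ennreal_ofReal (by simp)]
    simp only [Function.comp_apply, hsmul]
  · rw [← integral_map hS.aemeasurable hg.aestronglyMeasurable, h, integral_smul_measure,
      integral_map hT.aemeasurable hg'.aestronglyMeasurable,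
      integral_withDensity_eq_integral_toReal_smul hδ.ennreal_ofReal (by simp),
      ENNReal.toReal_ofReal hC.le, smul_eq_mul]
    simp only [hsmul]

end Transport

/-! ### The affine formula for a general absolute determinant. -/

section Formula

variable {F : Type} [NormedDivisionRing F] [NormedAlgebra ℝ F] [StarRing F] [StarNorm F]
  [MeasureSpace F] [BorelSpace F] [SecondCountableTopology F] [ContinuousStar F]
  [FiniteDimensional ℝ F] [(volume : Measure F).IsAddHaarMeasure]

theorem measurable_gram {m N : ℕ} :
    Measurable fun z : Fin N → Fin m → F => gram (columns z) := by
  rintro _ ⟨S, hS, rfl⟩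
  exact measurable_gramEntries hS

/-- Measurable subsets of the cone are by definition cut out by measurable sets of matrices, so
indicators in `lintegral_gramEntries` suffice. -/
theorem map_gram {β : ℕ} (hβ : Module.finrank ℝ F = β)
    (hgauss : ∫ x : F, Real.exp (-‖x‖ ^ 2) = Real.pi ^ ((β : ℝ) / 2))
    {D : ∀ N : ℕ, Matrix (Fin N) (Fin N) F → ℝ} (hD : IsAbsDet F D) {n N : ℕ} (hN : N ≤ n) :
    (volume : Measure (Fin N → Fin n → F)).map (fun z => gram (columns z)) =
      ENNReal.ofReal (grassmannVolume β n N) •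
        ((volume : Measure (Fin N → Fin N → F)).withDensity fun z =>
          ENNReal.ofReal (D N (columns z) ^ (β * (n - N)))).map fun z => gram (columns z) := by
  ext A hA
  have hA' := hA
  obtain ⟨S, hS, rfl⟩ := hA'
  have h := lintegral_gramEntries hβ hgauss hD hN (measurable_one.indicator hS)
  have e (m : ℕ) : (fun z : Fin N → Fin m → F => gram (columns z)) ⁻¹'
      ((fun (W : PSD F N) i j => W.1 i j) ⁻¹' S) = gramEntries ⁻¹' S := rfl
  have hm (m : ℕ) : MeasurableSet (gramEntries (F := F) (m := m) ⁻¹' S) :=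
    measurable_gramEntries hS
  rw [Measure.map_apply measurable_gram hA, Measure.smul_apply,
    Measure.map_apply measurable_gram hA, e, e, withDensity_apply _ (hm N), smul_eq_mul,
    ← lintegral_indicator_one (hm n), ← lintegral_indicator (hm N)]
  refine h.trans (congrArg _ (lintegral_congr fun z => ?_))
  by_cases hz : gramEntries z ∈ S <;> simp [hz]

theorem measurePreserving_sub_const {m N : ℕ} (a : Fin m → F) :
    MeasurePreserving fun (v : Fin N → Fin m → F) k => v k - a :=
  volume_preserving_pi fun _ => measurePreserving_sub_right volume a

/-- This is a shear: over each value of the first component it is a translation, so measurability of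
`c` is enough. -/
theorem measurePreserving_sub_fun {n m N : ℕ} {c : (Fin n → F) → Fin m → F} (hc : Measurable c) :
    MeasurePreserving fun p : (Fin n → F) × (Fin N → Fin m → F) =>
      (p.1, fun k => p.2 k - c p.1) :=
  (MeasurePreserving.id volume).skew_product (g := fun x (z : Fin N → Fin m → F) k => z k - c x)
    (by
      refine measurable_pi_iff.2 fun k => ?_
      exact ((measurable_pi_apply k).comp measurable_snd).sub (hc.comp measurable_fst))
    (ae_of_all _ fun x => (measurePreserving_sub_const (c x)).map_eq)

/-- The change of variables `(v_0, …, v_N) ↦ (v_0, (v_1 - v_0, …, v_N - v_0))`. -/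
theorem measurePreserving_sub_zero {n N : ℕ} :
    MeasurePreserving fun v : Fin (N + 1) → Fin n → F => (v 0, fun k : Fin N => v k.succ - v 0) :=
  (measurePreserving_sub_fun measurable_id).comp
    (volume_preserving_piFinSuccAbove (fun _ : Fin (N + 1) => Fin n → F) 0)

theorem affineFormula {β : ℕ} (hβ : Module.finrank ℝ F = β)
    (hgauss : ∫ x : F, Real.exp (-‖x‖ ^ 2) = Real.pi ^ ((β : ℝ) / 2))
    {D : ∀ N : ℕ, Matrix (Fin N) (Fin N) F → ℝ} (hD : IsAbsDet F D) {n N : ℕ} (hN : N ≤ n) :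
    AffineFormula F β (D N) n := by
  have hβ0 : 0 < β := hβ ▸ Module.finrank_pos
  set μ := (volume : Measure (Fin N → Fin n → F)).map (fun z => gram (columns z)) with hμ
  set d : (Fin N → Fin N → F) → ℝ := fun z => D N (columns z) ^ (β * (n - N)) with hd
  have hdm : Measurable d := (hD.measurable N).pow_const _
  have hd0 (z) : 0 ≤ d z := pow_nonneg (hD.nonneg _ _) _
  set ν := ((volume : Measure (Fin N → Fin N → F)).withDensity fun z =>
    ENNReal.ofReal (d z)).map fun z => gram (columns z) with hν
  have hμν : μ = ENNReal.ofReal (grassmannVolume β n N) • ν := map_gram hβ hgauss hD hN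
  have hC := grassmannVolume_pos hβ0 n N
  -- Since `f` is only almost everywhere measurable for `coneMeasure F N`, both image measures have
  -- to be absolutely continuous with respect to it.
  have hνac : ν ≪ coneMeasure F N := (withDensity_absolutelyContinuous _ _).map measurable_gram
  have hμac : μ ≪ coneMeasure F N := hμν ▸ (Measure.smul_absolutelyContinuous.trans hνac)
  -- the maps for the integrals over all the vectors
  have mS : Measurable fun v : Fin (N + 1) → Fin n → F =>
      (v 0, gram (columns fun k : Fin N => v k.succ - v 0)) :=
    (measurable_id.prodMap measurable_gram).comp measurePreserving_sub_zero.measurable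
  -- Keeping `v 0` next to the Gram matrix makes the image a product measure, so a weight in `v 0`
  -- is just a function of the first factor.
  have hS : (volume : Measure (Fin (N + 1) → Fin n → F)).map
      (fun v => (v 0, gram (columns fun k : Fin N => v k.succ - v 0))) = volume.prod μ := by
    have e := Measure.map_map (μ := (volume : Measure (Fin (N + 1) → Fin n → F)))
      (measurable_id.prodMap measurable_gram) (measurePreserving_sub_zero (F := F)).measurable
    rw [(measurePreserving_sub_zero (F := F)).map_eq, Measure.volume_eq_prod,
      ← Measure.map_prod_map _ _ measurable_id measurable_gram, Measure.map_id] at e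
    exact e.symm
  have mT {c : (Fin n → F) → Fin N → F} (hc : Measurable c) :
      Measurable fun p : (Fin n → F) × (Fin N → Fin N → F) =>
        (p.1, gram (columns fun k => p.2 k - c p.1)) :=
    (measurable_id.prodMap measurable_gram).comp (measurePreserving_sub_fun hc).measurable
  have mδ {c : (Fin n → F) → Fin N → F} (hc : Measurable c) :
      Measurable fun p : (Fin n → F) × (Fin N → Fin N → F) => d fun k => p.2 k - c p.1 :=
    hdm.comp (measurable_snd.comp (measurePreserving_sub_fun hc).measurable)
  have hT {c : (Fin n → F) → Fin N → F} (hc : Measurable c) :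
      ((volume : Measure ((Fin n → F) × (Fin N → Fin N → F))).withDensity fun p =>
        ENNReal.ofReal (d fun k => p.2 k - c p.1)).map
          (fun p => (p.1, gram (columns fun k => p.2 k - c p.1))) = volume.prod ν := by
    have e := map_withDensity_comp (measurePreserving_sub_fun hc)
      (d := fun p => ENNReal.ofReal (d p.2)) (hdm.comp measurable_snd).ennreal_ofReal
    have e' := congrArg (Measure.map (Prod.map id fun z => gram (columns z))) e
    rw [Measure.map_map (measurable_id.prodMap measurable_gram)
      (measurePreserving_sub_fun hc).measurable, Measure.volume_eq_prod,
      ← prod_withDensity_right hdm.ennreal_ofReal,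
      ← Measure.map_prod_map _ _ measurable_id measurable_gram, Measure.map_id] at e'
    exact e'
  have hST {c : (Fin n → F) → Fin N → F} (hc : Measurable c) := by
    have h := hS
    rw [hμν, Measure.prod_smul_right, ← hT hc] at h
    exact h
  refine ⟨fun f hf c hc => ?_, fun f hf c hc φ hφ => ?_, fun f hf a b => ?_⟩
  · have := lintegral_comp_eq_of_map_eq mS (mT hc) (mδ hc) (hST hc) (g := fun p => f p.2)
      (by rw [hS]; exact (hf.mono_ac hμac).comp_snd) (by rw [hT hc]; exact (hf.mono_ac hνac).comp_snd)
    exact this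
  · have hprod {κ : Measure (PSD F N)} [SFinite κ] (h : κ ≪ coneMeasure F N) :
        AEMeasurable (fun p : (Fin n → F) × PSD F N => φ p.1 * f p.2) (volume.prod κ) :=
      (hφ.comp measurable_fst).aemeasurable.mul (hf.mono_ac h).comp_snd
    have := integral_comp_eq_of_map_eq mS (mT hc) (mδ hc) (fun _ => hd0 _) hC (hST hc)
      (g := fun p => φ p.1 * f p.2) (by rw [hS]; exact hprod hμac) (by rw [hT hc]; exact hprod hνac)
    simpa only [mul_assoc] using this
  · have pa := measurePreserving_sub_const (N := N) a
    have pb := measurePreserving_sub_const (N := N) b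
    have ha : (volume : Measure (Fin N → Fin n → F)).map
        (fun v => gram (columns fun k => v k - a)) = μ := by
      rw [hμ]
      conv_rhs => rw [← pa.map_eq, Measure.map_map measurable_gram pa.measurable]
      rfl
    have hb : ((volume : Measure (Fin N → Fin N → F)).withDensity fun w =>
        ENNReal.ofReal (d fun k => w k - b)).map (fun w => gram (columns fun k => w k - b)) = ν := by
      rw [hν, ← map_withDensity_comp pb hdm.ennreal_ofReal,
        Measure.map_map measurable_gram pb.measurable]
      rfl
    exact integral_comp_eq_of_map_eq (measurable_gram.comp pa.measurable)
      (measurable_gram.comp pb.measurable) (hdm.comp pb.measurable) (fun _ => hd0 _) hC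
      (g := f) (by exact ha.trans (hμν.trans (by rw [← hb]; rfl)))
      (by exact ha ▸ hf.mono_ac hμac) (by exact hb ▸ hf.mono_ac hνac)

end Formula

/-! ### The absolute determinant over a commutative field. -/

section Commutative

theorem det_columns_cons {R : Type} [CommRing R] {N : ℕ} (c : R) (a : Fin N → R)
    (y : Fin N → Fin N → R) :
    (Matrix.of fun i k => (Fin.cons (Pi.single 0 c) fun k => Fin.cons (a k) (y k) :
      Fin (N + 1) → Fin (N + 1) → R) k i).det = c * (Matrix.of fun i k => y k i).det := by
  rw [Matrix.det_succ_column_zero, Fin.sum_univ_succ]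
  simp only [Matrix.of_apply, Fin.cons_zero, Pi.single_eq_same, Fin.val_zero, pow_zero, one_mul,
    ne_eq, Fin.succ_ne_zero, not_false_eq_true, Pi.single_eq_of_ne, mul_zero, zero_mul,
    Finset.sum_const_zero, add_zero]
  congr 2

variable {F : Type} [NormedField F] [NormedAlgebra ℝ F] [StarRing F] [StarNorm F]
  [MeasureSpace F] [BorelSpace F] [SecondCountableTopology F]

/-- Taking determinants in `U† U = 1` gives `|det U|² = 1`. The index type is general so that
complex forms of quaternion matrices are included. -/
theorem norm_det_unitary_mul {ι : Type} [Fintype ι] [DecidableEq ι] {U : Matrix ι ι F}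
    (hU : Uᴴ * U = 1) (M : Matrix ι ι F) : ‖(U * M).det‖ = ‖M.det‖ := by
  have h := congrArg Matrix.det hU
  rw [Matrix.det_mul, Matrix.det_conjTranspose, StarNorm.star_mul_self', Matrix.det_one,
    ← map_one (algebraMap ℝ F)] at h
  have h1 : ‖U.det‖ = 1 :=
    (pow_eq_one_iff_of_nonneg (norm_nonneg _) two_ne_zero).1 ((algebraMap ℝ F).injective h)
  rw [Matrix.det_mul, norm_mul, h1, one_mul]

theorem isAbsDet_norm_det : IsAbsDet F fun _ M => ‖M.det‖ where
  measurable N := by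
    have : Continuous fun z : Fin N → Fin N → F => ‖(columns z).det‖ := by
      refine (Continuous.matrix_det ?_).norm
      exact continuous_matrix fun i j => by unfold columns; simp only [Matrix.of_apply]; fun_prop
    exact this.measurable
  nonneg _ _ := norm_nonneg _
  of_zero M := by simp
  unitary_mul N U M hU := norm_det_unitary_mul hU M
  cons N r a y hr := by
    have := det_columns_cons (algebraMap ℝ F r) a y
    unfold columns
    rw [this, norm_mul, norm_algebraMap', Real.norm_of_nonneg hr.le]

end Commutative

/-! ### The absolute determinant over the quaternions. -/

section Quaternion

theorem block_add (p q : ℍ[ℝ]) : block (p + q) = block p + block q := by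
  ext i j
  fin_cases i <;> fin_cases j <;> apply Complex.ext <;> simp [block] <;> ring

theorem block_mul (p q : ℍ[ℝ]) : block (p * q) = block p * block q := by
  ext i j
  fin_cases i <;> fin_cases j <;> apply Complex.ext <;>
    simp [block, Matrix.mul_apply, Fin.sum_univ_two] <;> ring

theorem block_zero : block 0 = 0 := by
  ext i j
  fin_cases i <;> fin_cases j <;> apply Complex.ext <;> simp [block]

theorem block_coe (r : ℝ) : block (r : ℍ[ℝ]) = Matrix.diagonal fun _ => (r : ℂ) := by
  ext i j
  fin_cases i <;> fin_cases j <;> apply Complex.ext <;> simp [block]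

theorem block_star (q : ℍ[ℝ]) : block (star q) = (block q)ᴴ := by
  ext i j
  fin_cases i <;> fin_cases j <;> apply Complex.ext <;> simp [block]

theorem block_sum {ι : Type} (s : Finset ι) (f : ι → ℍ[ℝ]) :
    block (∑ i ∈ s, f i) = ∑ i ∈ s, block (f i) :=
  map_sum (⟨⟨block, block_zero⟩, block_add⟩ : ℍ[ℝ] →+ Matrix (Fin 2) (Fin 2) ℂ) f s

theorem continuous_block (i j : Fin 2) : Continuous fun q : ℍ[ℝ] => block q i j := by
  fin_cases i <;> fin_cases j <;>
    simp only [block, Fin.mk_zero, Fin.mk_one, Fin.isValue, Matrix.of_apply,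
      Matrix.cons_val_zero, Matrix.cons_val_one, Matrix.cons_val', Matrix.cons_val_fin_one,
      Complex.mk_eq_add_mul_I] <;>
    have h1 := Quaternion.continuous_re <;>
    have h2 := Quaternion.continuous_imI <;>
    have h3 := Quaternion.continuous_imJ <;>
    have h4 := Quaternion.continuous_imK <;>
    fun_prop

theorem complexForm_mul {N : ℕ} (A B : Matrix (Fin N) (Fin N) ℍ[ℝ]) :
    complexForm (A * B) = complexForm A * complexForm B := by
  ext ⟨i, s⟩ ⟨j, t⟩
  simp only [complexForm, Matrix.of_apply, Matrix.mul_apply, block_sum, block_mul,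
    Fintype.sum_prod_type, Matrix.sum_apply]

theorem complexForm_one {N : ℕ} : complexForm (1 : Matrix (Fin N) (Fin N) ℍ[ℝ]) = 1 := by
  ext ⟨i, s⟩ ⟨j, t⟩
  have h1 : block 1 = 1 := by simpa using block_coe 1
  rcases eq_or_ne i j with rfl | h
  · simp [complexForm, h1, Matrix.one_apply]
  · simp [complexForm, h, block_zero]

theorem complexForm_conjTranspose {N : ℕ} (A : Matrix (Fin N) (Fin N) ℍ[ℝ]) :
    complexForm Aᴴ = (complexForm A)ᴴ := by
  ext ⟨i, s⟩ ⟨j, t⟩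
  simp [complexForm, block_star]

/-- Splitting the first pair of rows off the complex form of a quaternion matrix. -/
def finSuccProdEquiv (N : ℕ) : Fin 2 ⊕ Fin N × Fin 2 ≃ Fin (N + 1) × Fin 2 :=
  Equiv.ofBijective (Sum.elim (fun s => (0, s)) fun p => (p.1.succ, p.2)) <| by
    constructor
    · rintro (s | ⟨i, s⟩) (t | ⟨j, t⟩) h <;> simp_all [Prod.ext_iff, eq_comm]
    · rintro ⟨i, s⟩
      refine Fin.cases ⟨.inl s, rfl⟩ (fun i => ⟨.inr (i, s), rfl⟩) i

/-- The complex form respects products and adjoints, so unitary invariance reduces to the complex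
case. -/
theorem isAbsDet_quatAbsDet : IsAbsDet ℍ[ℝ] fun _ M => quatAbsDet M where
  measurable N := by
    have : Continuous fun z : Fin N → Fin N → ℍ[ℝ] => quatAbsDet (columns z) := by
      refine (Continuous.matrix_det (continuous_matrix fun p q => ?_)).norm.sqrt
      exact (continuous_block p.2 q.2).comp
        ((continuous_apply p.1).comp (continuous_apply q.1))
    exact this.measurable
  nonneg _ _ := Real.sqrt_nonneg _
  of_zero M := by simp [quatAbsDet]
  unitary_mul N U M hU := by
    unfold quatAbsDet
    rw [complexForm_mul, norm_det_unitary_mul]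
    rw [← complexForm_conjTranspose, ← complexForm_mul, hU, complexForm_one]
  cons N r a y hr := by
    unfold quatAbsDet
    set M := complexForm (columns (Fin.cons (Pi.single 0 (algebraMap ℝ ℍ[ℝ] r))
      fun k => Fin.cons (a k) (y k))) with hM
    -- The quaternion column `(r, 0, …, 0)` becomes a pair of columns with `2 × 2` block `r · 1` on
    -- top and zeros below. The determinant gains `r²`, and its square root gains `r`.
    have h : M.submatrix (finSuccProdEquiv N) (finSuccProdEquiv N) =
        Matrix.fromBlocks (Matrix.diagonal fun _ => (r : ℂ))
          (M.submatrix (finSuccProdEquiv N ∘ Sum.inl) (finSuccProdEquiv N ∘ Sum.inr)) 0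
          (complexForm (columns y)) := by
      rw [← block_coe]
      ext (s | ⟨i, s⟩) (t | ⟨j, t⟩)
      · rfl
      · rfl
      · change block (Pi.single (M := fun _ => ℍ[ℝ]) 0 (algebraMap ℝ ℍ[ℝ] r) i.succ) s t = 0
        simp [block_zero]
      · rfl
    have hdet : M.det = (r : ℂ) ^ 2 * (complexForm (columns y)).det := by
      rw [← Matrix.det_submatrix_equiv_self (finSuccProdEquiv N), h,
        Matrix.det_fromBlocks_zero₂₁, Matrix.det_diagonal]
      simp
    rw [hdet, norm_mul, norm_pow, Complex.norm_real, Real.norm_of_nonneg hr.le,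
      Real.sqrt_mul (by positivity), Real.sqrt_sq hr.le]

end Quaternion

theorem integral_gaussian_norm {V : Type} [NormedAddCommGroup V] [InnerProductSpace ℝ V]
    [FiniteDimensional ℝ V] [MeasurableSpace V] [BorelSpace V] {β : ℕ}
    (hβ : Module.finrank ℝ V = β) :
    ∫ x : V, Real.exp (-‖x‖ ^ 2) = Real.pi ^ ((β : ℝ) / 2) := by
  simpa [hβ] using GaussianFourier.integral_rexp_neg_mul_sq_norm (V := V) one_pos

end AffineGram

end

theorem corollaryC3p6 (n N : ℕ) (hN : N ≤ n) :
    AffineGram.AffineFormula ℝ 1 (fun M : Matrix (Fin N) (Fin N) ℝ => |M.det|) n ∧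
    AffineGram.AffineFormula ℂ 2 (fun M : Matrix (Fin N) (Fin N) ℂ => ‖M.det‖) n ∧
    AffineGram.AffineFormula ℍ[ℝ] 4
      (fun M : Matrix (Fin N) (Fin N) ℍ[ℝ] => AffineGram.quatAbsDet M) n := by
  have : SecondCountableTopology ℍ[ℝ] := secondCountable_of_proper
  refine ⟨?_, ?_, ?_⟩
  · have hβ : Module.finrank ℝ ℝ = 1 := Module.finrank_self ℝ
    exact AffineGram.affineFormula hβ (AffineGram.integral_gaussian_norm hβ)
      AffineGram.isAbsDet_norm_det hN
  · have hβ : Module.finrank ℝ ℂ = 2 := Complex.finrank_real_complex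
    exact AffineGram.affineFormula hβ (AffineGram.integral_gaussian_norm hβ)
      AffineGram.isAbsDet_norm_det hN
  · have hβ : Module.finrank ℝ ℍ[ℝ] = 4 := Quaternion.finrank_eq_four
    exact AffineGram.affineFormula hβ (AffineGram.integral_gaussian_norm hβ)
      AffineGram.isAbsDet_quatAbsDet hN
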